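/- **Theorem 3 (Hybrid Scheme).** Let $K_1\ge K_2>L\ge 1$ and $N\ge 1$ be integers. *Model.* A server has $N$ files, each divided into $F$ packets of $B$ bits. There are $K_1K_2$ cache-nodes $C_{v_1,v_2}$ and $K_1K_2$ users $U_{u_1,u_2}$ on a $K_1\times K_2$ grid; user $U_{u_1,u_2}$ can read cache-node $C_{v_1,v_2}$ iff $(u_1-v_1)\bmod K_1<L$ and $(u_2-v_2)\bmod K_2<L$. In a scheme each cache-node stores, before the requests are known, at most $MF$ (possibly coded) packets; for each request vector $\mathbf d\in[N]^{K_1K_2}$ the server broadcasts $S_{\mathbf d}$ coded packets, from which, together with the contents of its accessible cache-nodes, every user recovers the file it requests. The load of the scheme is $\max_{\mathbf d}S_{\mathbf d}/F$. A pair $(M,R)$ is achievable if for every $\varepsilon>0$ there is a scheme, for some $F,B\geq 1$, with memory at most $M$ and load at most $R+\varepsilon$. *Arrays.* A $(K,F,Z,S)$ PDA ($K,F,Z\ge 1$, $S\ge 0$) is an $F\times K$ array $\mathbf P$ over $\{*\}\cup[S]$ such that: (C1) each column has exactly $Z$ stars; (C2) each $s\in[S]$ occurs; (C3) if $\mathbf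 P(j_1,k_1)=\mathbf P(j_2,k_2)=s\in[S]$ for distinct positions, then $\mathbf P(j_1,k_2)=\mathbf P(j_2,k_1)=*$. For row $j$ let $\mathcal A_j$ be its set of star columns, for a column $k$ let $c_j(k)=k+|\{a\in\mathcal A_j: a<k\}|\,(L-1)$, and let $\mathcal U_j=\bigcup_{a\in\mathcal A_j}\{c_j(a),c_j(a)+1,\dots,c_j(a)+L-1\}$. Further conditions, for a given $t$: (C4) $|\mathcal A_j|=t$ for every $j$; (C5) if $\mathbf P(j_1,k_1)=\mathbf P(j_2,k_2)\in[S]$ for distinct positions, then $c_{j_1}(k_1)\in\mathcal U_{j_2}$ and $c_{j_2}(k_2)\in\mathcal U_{j_1}$. The $t$-$(tK_2,\,K_2^t,\,LK_2^{t-1},\,K_2^t(K_2-L))$ Partition PDA is the array $(\mathbf H_1,\dots,\mathbf H_t)$ with rows $\mathbf f\in[K_2]^t$ and columns $k\in[K_2]$ in each block, where $\mathbf H_i(\mathbf f,k)=*$ if $(k-f_i)\bmod K_2<L$ and otherwise $\mathbf H_i(\mathbf f,k)=\phi\big(f_1,\dots,f_{i-1},k,f_{i+1},\dots,f_t,(f_i-k)\bmod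 K_2\big)$, for some one-to-one numbering $\phi$ of $[K_2]^t\times[K_2-L]$ by $[K_2^t(K_2-L)]$. *Claim.* Suppose that for each $t\in\{1,\dots,\lfloor K_1/L\rfloor\}$ we are given a $(K_1',F_1',Z_1',S_1')$ PDA with $K_1'=K_1-t(L-1)$ (where $F_1',Z_1',S_1'$ may depend on $t$) satisfying C1–C5 for this $t$, and a $t$-$(tK_2,K_2^t,LK_2^{t-1},K_2^t(K_2-L))$ Partition PDA. Then each of the corner points $$(M,R_3)=\left(\frac{Nt}{K_1K_2},\ \frac{K_2tL-tL^2}{t}+\frac{K_2S_1'}{F_1'}\right),\qquad t\in\{1,\dots,\lfloor K_1/L\rfloor\},$$ as well as $(M,R_3)=(0,K_1K_2)$ and $(M,R_3)=(N/L^2,0)$, is attained by a scheme (memory at most $M$ and load at most $R_3$), and the lower convex envelope of all these points is achievable: for every $M\in[0,N/L^2]$ the pair $(M,R)$ is achievable, where $R$ is the value of the envelope at $M$. -/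

import Mathlib

namespace MACC

section PlacementDeliveryArrays

/-- An `F × K` array with entries in `{*} ∪ [S]`; the star `*` is `none`. -/
abbrev StarArray (F K S : ℕ) : Type := Fin F → Fin K → Option (Fin S)

/-- `(K, F, Z, S)` placement delivery array. `S = 0` (an array of stars only) is allowed. -/
structure IsPDA {F K S : ℕ} (Z : ℕ) (P : StarArray F K S) : Prop where
  K_pos : 0 < K
  F_pos : 0 < F
  Z_pos : 0 < Z
  /-- C1: the star appears `Z` times in each column. -/
  c1 : ∀ k : Fin K, (Finset.univ.filter fun j : Fin F => P j k = none).card = Z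
  /-- C2: each integer of `[S]` occurs at least once. -/
  c2 : ∀ s : Fin S, ∃ j k, P j k = some s
  /-- C3: two distinct entries with the same integer see stars at the two opposite corners. -/
  c3 : ∀ (s : Fin S) (j₁ j₂ : Fin F) (k₁ k₂ : Fin K), (j₁, k₁) ≠ (j₂, k₂) →
    P j₁ k₁ = some s → P j₂ k₂ = some s → P j₁ k₂ = none ∧ P j₂ k₁ = none

/-- C4: each row has exactly `t` stars. -/
def CondC4 {F K S : ℕ} (t : ℕ) (P : StarArray F K S) : Prop :=
  ∀ j : Fin F, (Finset.univ.filter fun k : Fin K => P j k = none).card = t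

/-- If `k` is the `i`-th smallest element of `A_j ∪ {k}`, where `A_j` is the set of star columns
of row `j`, this is `k + (i - 1)(L - 1)`: note that `i - 1` is the number of stars of row `j`
strictly to the left of `k`. (Columns are counted from `0`.) -/
def stretch {F K S : ℕ} (L : ℕ) (P : StarArray F K S) (j : Fin F) (k : Fin K) : ℕ :=
  (k : ℕ) + (Finset.univ.filter fun a : Fin K => P j a = none ∧ a < k).card * (L - 1)

/-- The set `U_j`: the union over the star columns `a` of row `j` of the `L` consecutive
integers starting at the stretched position of `a`. -/
def retrieveSet {F K S : ℕ} (L : ℕ) (P : StarArray F K S) (j : Fin F) : Set ℕ :=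
  {c | ∃ a : Fin K, P j a = none ∧ ∃ l : ℕ, l < L ∧ c = stretch L P j a + l}

/-- C5: for two distinct entries with the same integer, the stretched column of each of them
belongs to the retrieve set of the row of the other one. -/
def CondC5 {F K S : ℕ} (L : ℕ) (P : StarArray F K S) : Prop :=
  ∀ (s : Fin S) (j₁ j₂ : Fin F) (k₁ k₂ : Fin K), (j₁, k₁) ≠ (j₂, k₂) →
    P j₁ k₁ = some s → P j₂ k₂ = some s →
    stretch L P j₁ k₁ ∈ retrieveSet L P j₂ ∧ stretch L P j₂ k₂ ∈ retrieveSet L P j₁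

/-- The `m`-`(mq, q^m, z q^(m-1), q^m (q - z))` Partition PDA `(H_1, …, H_m)`: rows are indexed by
`f ∈ [q]^m`, column `k` of the block `H_i` by `(i, k)`. The entry is a star if
`k ∈ {f_i, f_i + 1, …, f_i + z - 1}` modulo `q`; otherwise it is the integer that a one-to-one
numbering `φ` of the vectors in `[q]^m × [q - z]` assigns to
`(f_1, …, f_(i-1), k, f_(i+1), …, f_m, (f_i - k) mod q)`. Subtraction in `Fin q` is modulo `q`. -/
def IsPartitionPDA {m q : ℕ} (z : ℕ)
    (H : (Fin m → Fin q) → Fin m × Fin q → Option (Fin (q ^ m * (q - z)))) : Prop :=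
  ∃ φ : (Fin m → Fin q) × ℕ → Fin (q ^ m * (q - z)),
    Set.InjOn φ {v | 1 ≤ v.2 ∧ v.2 ≤ q - z} ∧
    ∀ (f : Fin m → Fin q) (i : Fin m) (k : Fin q),
      H f (i, k) =
        if ((k - f i : Fin q) : ℕ) < z then none
        else some (φ (Function.update f i k, ((f i - k : Fin q) : ℕ)))

end PlacementDeliveryArrays

section Model

/-- User `u` of the `K₁ × K₂` grid can read cache-node `v` iff both cyclic distances
`(u₁ - v₁) mod K₁` and `(u₂ - v₂) mod K₂` are smaller than `L`. -/
def Accesses {K₁ K₂ : ℕ} (L : ℕ) (u v : Fin K₁ × Fin K₂) : Prop :=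
  ((u.1 - v.1 : Fin K₁) : ℕ) < L ∧ ((u.2 - v.2 : Fin K₂) : ℕ) < L

/-- A packet of `B` bits. -/
abbrev Packet (B : ℕ) : Type := Fin B → Bool

/-- The library: `N` files of `F` packets of `B` bits. -/
abbrev Library (N F B : ℕ) : Type := Fin N → Fin F → Packet B

/-- A two-dimensional multi-access coded caching scheme for a `K₁ × K₂` grid of cache-nodes and
users with access parameter `L` and a library of `N` files, each divided into `F` packets of
`B` bits. -/
structure Scheme (K₁ K₂ L N F B : ℕ) where
  /-- Number of (possibly coded) packets held by each cache-node. -/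
  cacheSize : ℕ
  /-- Placement phase: it does not depend on the requests. -/
  place : Fin K₁ × Fin K₂ → Library N F B → Fin cacheSize → Packet B
  /-- Number `S_d` of packets transmitted for the request vector `d`. -/
  numSent : (Fin K₁ × Fin K₂ → Fin N) → ℕ
  /-- Delivery phase: the transmitted coded packets. -/
  send : (d : Fin K₁ × Fin K₂ → Fin N) → Library N F B → Fin (numSent d) → Packet B
  /-- Decoding function of user `u`: its inputs are the request vector, the transmitted packets and
  the contents of the cache-nodes that `u` can access. -/
  decode : (u : Fin K₁ × Fin K₂) → (d : Fin K₁ × Fin K₂ → Fin N) →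
    (Fin (numSent d) → Packet B) →
    ({v : Fin K₁ × Fin K₂ // Accesses L u v} → Fin cacheSize → Packet B) → Fin F → Packet B
  /-- Each user recovers the file it requests. -/
  decode_eq : ∀ (W : Library N F B) (d : Fin K₁ × Fin K₂ → Fin N) (u : Fin K₁ × Fin K₂),
    decode u d (send d W) (fun v => place v.1 W) = W (d u)

/-- Some scheme has cache-nodes of size at most `M` files (`M F` packets) and worst-case load
`max_d S_d / F` at most `R`. -/
def AttainedByScheme (K₁ K₂ L N : ℕ) (M R : ℝ) : Prop :=
  ∃ F B : ℕ, 0 < F ∧ 0 < B ∧ ∃ σ : Scheme K₁ K₂ L N F B,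
    (σ.cacheSize : ℝ) ≤ M * F ∧ ∀ d, (σ.numSent d : ℝ) / F ≤ R

/-- The memory-load pair `(M, R)` is achievable: with memory `M`, loads arbitrarily close to `R`
are attained. -/
def Achievable (K₁ K₂ L N : ℕ) (M R : ℝ) : Prop :=
  ∀ ε : ℝ, 0 < ε → AttainedByScheme K₁ K₂ L N M (R + ε)

end Model

/-- Lower convex envelope of a set of points of the plane, at an abscissa `x` of its convex hull:
the smallest ordinate of a point of the convex hull above `x`. -/
noncomputable def lowerConvexEnvelope (A : Set (ℝ × ℝ)) (x : ℝ) : ℝ :=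
  sInf {y : ℝ | (x, y) ∈ convexHull ℝ A}

/-- The memory-load corner points of the hybrid scheme, `F' t` and `S' t` being the number of rows
and of integers of the placement delivery array used for `t`. -/
def hybridCorners (K₁ K₂ L N : ℕ) (F' S' : ℕ → ℕ) : Set (ℝ × ℝ) :=
  {((0 : ℝ), (K₁ : ℝ) * K₂), ((N : ℝ) / (L : ℝ) ^ 2, (0 : ℝ))} ∪
  {p | ∃ t ∈ Finset.Icc 1 (K₁ / L),
    p = ((N : ℝ) * t / ((K₁ : ℝ) * K₂),
      ((K₂ : ℝ) * t * L - t * (L : ℝ) ^ 2) / t + (K₂ : ℝ) * (S' t : ℝ) / (F' t : ℝ))}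

end MACC

namespace MACC

/-! The load at a corner depends on the given array through the ratio `S' / F'` alone, and C3 with
C4 bound this ratio from below. An integer occurs at most `t + 1` times, so `S' / F' ≥ (K' - t) / (t
+ 1)`, with equality for the Maddah-Ali–Niesen array on `t`-subsets of `[K']` (`IsPDA.mul_sub_le`).
It is therefore enough to build one hybrid scheme for each `t`, with that array in the first
dimension and the Partition PDA in the second (`hasCode_hybrid`).

At memory `0` the files are sent uncoded; at memory `N / L ^ 2` each user reads `L ^ 2` symbols of a
Reed-Solomon code, which determine its file. Memory sharing makes the achievable region convex
(`convex_achievable`), so it contains the convex hull of the corners; the `ε` in achievability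
absorbs both irrational weights and an infimum that might not be attained. -/

/-! ### Codes without explicit decoders, and their combinations -/

/-- A caching code in information-theoretic form: files are `I`-indexed families of symbols of `X`,
each cache-node holds a `C`-indexed family of symbols, a `T`-indexed family of symbols is
transmitted, and what each user sees determines the file that it requests. -/
def HasCode (K₁ K₂ L N : ℕ) (I C T X : Type) : Prop :=
  ∃ (place : Fin K₁ × Fin K₂ → (Fin N → I → X) → C → X)
    (send : (Fin K₁ × Fin K₂ → Fin N) → (Fin N → I → X) → T → X),
    ∀ d u W W', send d W = send d W' → (∀ v, Accesses L u v → place v W = place v W') →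
      W (d u) = W' (d u)

namespace HasCode

variable {K₁ K₂ L N : ℕ} {I C T X : Type}

theorem pi (β : Type) (h : HasCode K₁ K₂ L N I C T X) : HasCode K₁ K₂ L N I C T (β → X) := by
  obtain ⟨place, send, h⟩ := h
  refine ⟨fun v W c b => place v (fun n i => W n i b) c,
    fun d W c b => send d (fun n i => W n i b) c, fun d u W W' hs hp => ?_⟩
  funext i b
  refine congrFun (h d u (fun n i => W n i b) (fun n i => W' n i b) ?_ fun v hv => ?_) i
  · funext c
    exact congrFun (congrFun hs c) b
  · funext c
    exact congrFun (congrFun (hp v hv) c) b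

theorem copies (γ : Type) (h : HasCode K₁ K₂ L N I C T X) :
    HasCode K₁ K₂ L N (γ × I) (γ × C) (γ × T) X := by
  obtain ⟨place, send, h⟩ := h
  refine ⟨fun v W c => place v (fun n i => W n (c.1, i)) c.2,
    fun d W c => send d (fun n i => W n (c.1, i)) c.2, fun d u W W' hs hp => ?_⟩
  funext ⟨g, i⟩
  refine congrFun (h d u (fun n i => W n (g, i)) (fun n i => W' n (g, i)) ?_ fun v hv => ?_) i
  · funext c
    exact congrFun hs (g, c)
  · funext c
    exact congrFun (hp v hv) (g, c)

theorem sum {I' C' T' : Type} (h : HasCode K₁ K₂ L N I C T X) (h' : HasCode K₁ K₂ L N I' C' T' X) :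
    HasCode K₁ K₂ L N (I ⊕ I') (C ⊕ C') (T ⊕ T') X := by
  obtain ⟨place, send, h⟩ := h
  obtain ⟨place', send', h'⟩ := h'
  refine ⟨fun v W => Sum.elim (place v fun n i => W n (.inl i)) (place' v fun n i => W n (.inr i)),
    fun d W => Sum.elim (send d fun n i => W n (.inl i)) (send' d fun n i => W n (.inr i)),
    fun d u W W' hs hp => ?_⟩
  funext i
  rcases i with i | i
  · refine congrFun (h d u (fun n i => W n (.inl i)) (fun n i => W' n (.inl i)) ?_
      fun v hv => ?_) i
    · funext c
      exact congrFun hs (.inl c)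
    · funext c
      exact congrFun (hp v hv) (.inl c)
  · refine congrFun (h' d u (fun n i => W n (.inr i)) (fun n i => W' n (.inr i)) ?_
      fun v hv => ?_) i
    · funext c
      exact congrFun hs (.inr c)
    · funext c
      exact congrFun (hp v hv) (.inr c)

theorem congr {I' C' T' X' : Type} (h : HasCode K₁ K₂ L N I C T X) (eI : I ≃ I') (eC : C ≃ C')
    (eT : T ≃ T') (eX : X ≃ X') : HasCode K₁ K₂ L N I' C' T' X' := by
  obtain ⟨place, send, h⟩ := h
  refine ⟨fun v W c => eX (place v (fun n i => eX.symm (W n (eI i))) (eC.symm c)),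
    fun d W c => eX (send d (fun n i => eX.symm (W n (eI i))) (eT.symm c)),
    fun d u W W' hs hp => ?_⟩
  funext i
  obtain ⟨i, rfl⟩ := eI.surjective i
  apply eX.symm.injective
  refine congrFun (h d u (fun n i => eX.symm (W n (eI i))) (fun n i => eX.symm (W' n (eI i))) ?_
    fun v hv => ?_) i
  · funext c
    simpa using congrFun hs (eT c)
  · funext c
    simpa using congrFun (hp v hv) (eC c)

theorem attainedByScheme [Fintype I] [Fintype C] [Fintype T] {B : ℕ} {M R : ℝ}
    (h : HasCode K₁ K₂ L N I C T (Packet B)) (hB : 0 < B) (hI : 0 < Fintype.card I)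
    (hM : (Fintype.card C : ℝ) ≤ M * Fintype.card I)
    (hR : (Fintype.card T : ℝ) ≤ R * Fintype.card I) : AttainedByScheme K₁ K₂ L N M R := by
  obtain ⟨place, send, h⟩ := h.congr (Fintype.equivFin I) (Fintype.equivFin C)
    (Fintype.equivFin T) (Equiv.refl _)
  have key : ∀ u d, ∃ dec : (Fin (Fintype.card T) → Packet B) →
      ({v : Fin K₁ × Fin K₂ // Accesses L u v} → Fin (Fintype.card C) → Packet B) →
      Fin (Fintype.card I) → Packet B,
      ∀ W, dec (send d W) (fun v => place v.1 W) = W (d u) := by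
    intro u d
    classical
    -- The decoder picks any library consistent with what the user sees; all of them agree on the
    -- requested file.
    refine ⟨fun x y => if hx : ∃ W, send d W = x ∧ (fun v => place v.1 W) = y
      then hx.choose (d u) else fun _ _ => false, fun W => ?_⟩
    have hx : ∃ W', send d W' = send d W ∧
      (fun v : {v : Fin K₁ × Fin K₂ // Accesses L u v} => place v.1 W') =
        fun v => place v.1 W := ⟨W, rfl, rfl⟩
    simp only [dif_pos hx]
    exact h d u _ _ hx.choose_spec.1 fun v hv => congrFun hx.choose_spec.2 ⟨v, hv⟩
  choose dec hdec using key
  refine ⟨Fintype.card I, B, hI, hB,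
    ⟨Fintype.card C, place, fun _ => Fintype.card T, send, dec, fun W d u => hdec u d W⟩, hM,
    fun d => ?_⟩
  rw [div_le_iff₀ (by exact_mod_cast hI)]
  exact hR

end HasCode

/-! ### Memory sharing and convexity -/

variable {K₁ K₂ L N : ℕ}

theorem AttainedByScheme.exists_hasCode (hN : 1 ≤ N) {M R : ℝ}
    (h : AttainedByScheme K₁ K₂ L N M R) :
    ∃ F B c s : ℕ, 0 < F ∧ 0 < B ∧ (c : ℝ) ≤ M * F ∧ (s : ℝ) ≤ R * F ∧
      HasCode K₁ K₂ L N (Fin F) (Fin c) (Fin s) (Fin B → Bool) := by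
  obtain ⟨F, B, hF, hB, σ, hM, hR⟩ := h
  have : Nonempty (Fin N) := ⟨⟨0, hN⟩⟩
  obtain ⟨d₀, hd₀⟩ := Finite.exists_max σ.numSent
  -- Every transmission is padded with zero packets to the worst-case length.
  refine ⟨F, B, σ.cacheSize, σ.numSent d₀, hF, hB, hM, ?_, σ.place,
    fun d W i => if hi : i.1 < σ.numSent d then σ.send d W ⟨i, hi⟩ else fun _ => false,
    fun d u W W' hs hp => ?_⟩
  · have := hR d₀
    rwa [div_le_iff₀ (by exact_mod_cast hF)] at this
  · rw [← σ.decode_eq W d u, ← σ.decode_eq W' d u]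
    congr 1
    · funext i
      simpa using congrFun hs ⟨i.1, i.2.trans_le (hd₀ d)⟩
    · funext v
      exact hp v.1 v.2

/-- Memory sharing with rational weights. -/
theorem AttainedByScheme.mix (hN : 1 ≤ N) {M₁ R₁ M₂ R₂ : ℝ}
    (h₁ : AttainedByScheme K₁ K₂ L N M₁ R₁) (h₂ : AttainedByScheme K₁ K₂ L N M₂ R₂) (a b : ℕ)
    (hab : 0 < a + b) :
    AttainedByScheme K₁ K₂ L N ((a * M₁ + b * M₂) / (a + b)) ((a * R₁ + b * R₂) / (a + b)) := by
  obtain ⟨F₁, B₁, c₁, s₁, hF₁, hB₁, hM₁, hR₁, h₁⟩ := h₁.exists_hasCode hN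
  obtain ⟨F₂, B₂, c₂, s₂, hF₂, hB₂, hM₂, hR₂, h₂⟩ := h₂.exists_hasCode hN
  have e₁ : (Fin B₂ → Fin B₁ → Bool) ≃ Packet (B₂ * B₁) :=
    (Equiv.curry _ _ _).symm.trans (Equiv.arrowCongr finProdFinEquiv (Equiv.refl _))
  have e₂ : (Fin B₁ → Fin B₂ → Bool) ≃ Packet (B₂ * B₁) :=
    (Equiv.curry _ _ _).symm.trans
      (Equiv.arrowCongr ((Equiv.prodComm _ _).trans finProdFinEquiv) (Equiv.refl _))
  -- Packets of `B₂ * B₁` bits suit both codes; `a * F₂` and `b * F₁` copies give the parts sizes in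
  -- ratio `a : b`.
  have key := ((((h₁.pi (Fin B₂)).congr (.refl _) (.refl _) (.refl _) e₁).copies
    (Fin (a * F₂))).sum
    (((h₂.pi (Fin B₁)).congr (.refl _) (.refl _) (.refl _) e₂).copies (Fin (b * F₁))))
  have hpos : (0 : ℝ) < a + b := by exact_mod_cast hab
  refine key.attainedByScheme (by positivity) ?_ ?_ ?_
  · simp only [Fintype.card_sum, Fintype.card_prod, Fintype.card_fin]
    calc 0 < (a + b) * (F₁ * F₂) := by positivity
      _ = _ := by ring
  all_goals
    simp only [Fintype.card_sum, Fintype.card_prod, Fintype.card_fin]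
    push_cast
    rw [div_mul_eq_mul_div, le_div_iff₀ hpos]
  · calc ((a * F₂ * c₁ + b * F₁ * c₂ : ℝ)) * (a + b)
        ≤ (a * F₂ * (M₁ * F₁) + b * F₁ * (M₂ * F₂)) * (a + b) := by gcongr
      _ = _ := by ring
  · calc ((a * F₂ * s₁ + b * F₁ * s₂ : ℝ)) * (a + b)
        ≤ (a * F₂ * (R₁ * F₁) + b * F₁ * (R₂ * F₂)) * (a + b) := by gcongr
      _ = _ := by ring

theorem AttainedByScheme.mono {M M' R R' : ℝ} (h : AttainedByScheme K₁ K₂ L N M R) (hM : M ≤ M')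
    (hR : R ≤ R') : AttainedByScheme K₁ K₂ L N M' R' := by
  obtain ⟨F, B, hF, hB, σ, h₁, h₂⟩ := h
  exact ⟨F, B, hF, hB, σ, h₁.trans (by gcongr), fun d => (h₂ d).trans hR⟩

/-- Memory sharing with real weights, when the weight of the cheaper scheme can be rounded up. -/
theorem Achievable.mix_of_le (hN : 1 ≤ N) {M₁ R₁ M₂ R₂ : ℝ} (h₁ : Achievable K₁ K₂ L N M₁ R₁)
    (h₂ : Achievable K₁ K₂ L N M₂ R₂) (hM : M₁ ≤ M₂) {x y : ℝ} (hx : 0 ≤ x) (hy : 0 ≤ y)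
    (hxy : x + y = 1) : Achievable K₁ K₂ L N (x * M₁ + y * M₂) (x * R₁ + y * R₂) := by
  intro ε hε
  -- Memory has no slack, so the weight of the scheme with less memory is rounded up to a multiple
  -- of `1 / n`. The load then grows by at most `|R₁ - R₂| / n < ε / 2`.
  obtain ⟨n, hn⟩ := exists_nat_gt (2 * |R₁ - R₂| / ε)
  have hn0 : (0 : ℝ) < n := lt_of_le_of_lt (by positivity) hn
  have hnN : 0 < n := by exact_mod_cast hn0
  have hx1 : x ≤ 1 := by linarith
  have ha : ⌈x * n⌉₊ ≤ n := Nat.ceil_le.2 (by nlinarith)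
  obtain ⟨b, hb⟩ := Nat.exists_eq_add_of_le ha
  have ha1 := Nat.le_ceil (x * n)
  have ha2 := Nat.ceil_lt_add_one (a := x * n) (by positivity)
  generalize ⌈x * n⌉₊ = a at *
  have key := (h₁ (ε / 2) (by positivity)).mix hN (h₂ (ε / 2) (by positivity)) a b (by omega)
  have hnab : (n : ℝ) = a + b := by exact_mod_cast hb
  rw [← hnab] at key
  have hb' : (b : ℝ) = n - a := by linarith
  refine key.mono ?_ ?_
  · rw [div_le_iff₀ hn0, hb', show y = 1 - x by linarith]
    nlinarith
  · rw [div_le_iff₀ hn0, hb', show y = 1 - x by linarith]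
    have h1 : (a - x * n) * (R₁ - R₂) ≤ |R₁ - R₂| := by
      calc (a - x * n) * (R₁ - R₂) ≤ (a - x * n) * |R₁ - R₂| := by
            exact mul_le_mul_of_nonneg_left (le_abs_self _) (by linarith)
        _ ≤ 1 * |R₁ - R₂| := by
            gcongr
            linarith
        _ = _ := one_mul _
    rw [div_lt_iff₀ hε] at hn
    nlinarith

theorem convex_achievable (hN : 1 ≤ N) : Convex ℝ {p : ℝ × ℝ | Achievable K₁ K₂ L N p.1 p.2} := by
  rintro ⟨M₁, R₁⟩ h₁ ⟨M₂, R₂⟩ h₂ x y hx hy hxy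
  simp only [Set.mem_ofPred_eq, Prod.smul_mk, Prod.mk_add_mk, smul_eq_mul] at h₁ h₂ ⊢
  rcases le_total M₁ M₂ with h | h
  · exact h₁.mix_of_le hN h₂ h hx hy hxy
  · rw [add_comm (x * M₁), add_comm (x * R₁)]
    exact h₂.mix_of_le hN h₁ h hy hx (by linarith)

/-- If the points of a set are attained by schemes, then its lower convex envelope is achievable. -/
theorem achievable_lowerConvexEnvelope (hN : 1 ≤ N) {A : Set (ℝ × ℝ)}
    (hA : ∀ p ∈ A, AttainedByScheme K₁ K₂ L N p.1 p.2) {M : ℝ}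
    (hM : ∃ y, (M, y) ∈ convexHull ℝ A) :
    Achievable K₁ K₂ L N M (lowerConvexEnvelope A M) := by
  intro ε hε
  obtain ⟨y, hy, hlt⟩ := Real.lt_sInf_add_pos (s := {y : ℝ | (M, y) ∈ convexHull ℝ A}) hM
    (half_pos hε)
  have hsub : convexHull ℝ A ⊆ {p : ℝ × ℝ | Achievable K₁ K₂ L N p.1 p.2} :=
    convexHull_min (fun p hp ε hε => (hA p hp).mono le_rfl (by linarith)) (convex_achievable hN)
  refine (hsub hy (ε / 2) (half_pos hε)).mono le_rfl ?_
  simp only [lowerConvexEnvelope]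
  linarith

/-! ### The two extreme corners -/

/-- Without caches, each user is sent its file. -/
theorem attainedByScheme_zero_memory :
    AttainedByScheme K₁ K₂ L N 0 ((K₁ : ℝ) * K₂) := by
  have h : HasCode K₁ K₂ L N (Fin 1) (Fin 0) (Fin K₁ × Fin K₂) (Packet 1) :=
    ⟨fun _ _ i => i.elim0, fun d W u => W (d u) 0, fun d u W W' hs _ => by
      funext i
      rw [Subsingleton.elim i 0]
      exact congrFun hs u⟩
  exact h.attainedByScheme one_pos (by simp) (by simp) (by simp)

theorem accesses_sub [NeZero K₁] [NeZero K₂] (u : Fin K₁ × Fin K₂) {a b : ℕ} (ha : a < L)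
    (hb : b < L) (h₁ : L ≤ K₁) (h₂ : L ≤ K₂) :
    Accesses L u (u.1 - Fin.ofNat K₁ a, u.2 - Fin.ofNat K₂ b) := by
  simp only [Accesses, sub_sub_cancel, Fin.val_ofNat]
  rw [Nat.mod_eq_of_lt (by omega), Nat.mod_eq_of_lt (by omega)]
  exact ⟨ha, hb⟩

open Polynomial in
/-- Each cache-node holds, for each file, one symbol of a Reed-Solomon code of dimension `L ^ 2`. -/
theorem hasCode_reedSolomon {E : Type} [Field E] (hLK₁ : L ≤ K₁) (hLK₂ : L ≤ K₂)
    (α : Fin K₁ × Fin K₂ ↪ E) : HasCode K₁ K₂ L N (Fin (L ^ 2)) (Fin N) (Fin 0) E := by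
  classical
  refine ⟨fun v W n => (ofFn (L ^ 2) (W n)).eval (α v), fun _ _ i => i.elim0,
    fun d u W W' _ hp => ?_⟩
  have : NeZero K₁ := ⟨by have := u.1.2; omega⟩
  have : NeZero K₂ := ⟨by have := u.2.2; omega⟩
  have hcard : (Finset.univ : Finset (Fin L × Fin L)).card = L ^ 2 := by simp [sq]
  have hdeg : ∀ v : Fin (L ^ 2) → E,
      (ofFn (L ^ 2) v).degree < (Finset.univ : Finset (Fin L × Fin L)).card := fun v => by
    rw [hcard]
    exact ofFn_degree_lt v
  have key : ofFn (L ^ 2) (W (d u)) = ofFn (L ^ 2) (W' (d u)) := by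
    refine eq_of_degrees_lt_of_eval_index_eq (Finset.univ : Finset (Fin L × Fin L))
      (v := fun a => α (u.1 - Fin.ofNat K₁ a.1, u.2 - Fin.ofNat K₂ a.2)) ?_
      (hdeg _) (hdeg _) fun a _ =>
        congrFun (hp _ (accesses_sub u a.1.2 a.2.2 hLK₁ hLK₂)) (d u)
    rintro ⟨a, b⟩ - ⟨a', b'⟩ - h
    have h := α.injective h
    simp only [Prod.mk.injEq, sub_right_inj, Fin.ext_iff, Fin.val_ofNat] at h ⊢
    rwa [Nat.mod_eq_of_lt (by omega), Nat.mod_eq_of_lt (by omega), Nat.mod_eq_of_lt (by omega),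
      Nat.mod_eq_of_lt (by omega)] at h
  funext i
  have := congrArg (fun p : E[X] => p.coeff i) key
  simpa using this

/-- With a memory of `N / L ^ 2` files, the caches suffice. -/
theorem attainedByScheme_zero_load (hLK₁ : L ≤ K₁) (hLK₂ : L ≤ K₂) (hL : 1 ≤ L) :
    AttainedByScheme K₁ K₂ L N ((N : ℝ) / (L : ℝ) ^ 2) 0 := by
  -- The field needs a distinct evaluation point for each of the `K₁ * K₂` cache-nodes; `2 ^ (K₁ *
  -- K₂ + 1)` elements suffice.
  have hB : K₁ * K₂ + 1 ≠ 0 := by omega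
  have eB : GaloisField 2 (K₁ * K₂ + 1) ≃ Packet (K₁ * K₂ + 1) := by
    have := Fintype.ofFinite (GaloisField 2 (K₁ * K₂ + 1))
    refine Fintype.equivOfCardEq ?_
    rw [← Nat.card_eq_fintype_card, GaloisField.card 2 _ hB]
    simp
  have hle : Fintype.card (Fin K₁ × Fin K₂) ≤ Fintype.card (Packet (K₁ * K₂ + 1)) := by
    simpa using (Nat.le_succ _).trans (Nat.lt_two_pow_self (n := K₁ * K₂ + 1)).le
  obtain ⟨α⟩ := Function.Embedding.nonempty_of_card_le hle
  have h := (hasCode_reedSolomon (N := N) hLK₁ hLK₂ (α.trans eB.symm.toEmbedding)).congr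
    (.refl _) (.refl _) (.refl _) eB
  have hL0 : (L : ℝ) ≠ 0 := by positivity
  refine h.attainedByScheme (by omega) ?_ ?_ (by simp)
  · simp only [Fintype.card_fin]
    positivity
  · simp [hL0]

/-! ### The hybrid code -/

theorem ofNat_add (K : ℕ) [NeZero K] (a b : ℕ) :
    Fin.ofNat K (a + b) = Fin.ofNat K a + Fin.ofNat K b := by
  ext
  simp [Fin.val_add]

/-- The first position of the `i`-th of the blocks of `L` consecutive positions obtained by
stretching the elements of `D`. -/
def blockStart {t K : ℕ} (L : ℕ) (D : Fin t ↪o Fin K) (i : Fin t) : ℕ :=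
  (D i : ℕ) + i * (L - 1)

theorem strictMono_insertNth_of_lt {t K : ℕ} (D : Fin t ↪o Fin K) (o : Fin (t + 1)) (k : Fin K)
    (h₁ : ∀ i : Fin t, i.castSucc < o → D i < k) (h₂ : ∀ i : Fin t, o ≤ i.castSucc → k < D i) :
    StrictMono (o.insertNth (α := fun _ => Fin K) k D) := by
  intro a b hab
  induction a using o.succAboveCases with
  | x =>
    induction b using o.succAboveCases with
    | x => exact absurd hab (lt_irrefl _)
    | p j => simpa using h₂ j ((Fin.lt_succAbove_iff_le_castSucc _ _).1 hab)
  | p i =>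
    induction b using o.succAboveCases with
    | x => simpa using h₁ i ((Fin.succAbove_lt_iff_castSucc_lt _ _).1 hab)
    | p j => simpa using o.strictMono_succAbove.lt_iff_lt.1 hab

/-- A position either lies in one of the blocks of `D`, or is the stretched position of an element
by which `D` can be enlarged. -/
theorem mem_block_or_exists_insertNth {t K : ℕ} (hL : 1 ≤ L) (D : Fin t ↪o Fin K) {y : ℕ}
    (hy : y < K + t * (L - 1)) :
    (∃ i, ∃ l < L, y = blockStart L D i + l) ∨
      ∃ (X : Fin (t + 1) ↪o Fin K) (o : Fin (t + 1)), (∀ i, X (o.succAbove i) = D i) ∧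
        y = X o + o * (L - 1) := by
  by_cases hA : ∃ i, ∃ l < L, y = blockStart L D i + l
  · exact .inl hA
  right
  classical
  have hex : ∃ m, ∀ h : m < t, y < blockStart L D ⟨m, h⟩ := ⟨t, fun h => absurd h (lt_irrefl _)⟩
  -- `m` counts the blocks that start at or before `y`. If `y` is in none of them, all `m` end
  -- before `y`, and `y - m * (L - 1)` falls strictly between the neighbouring elements of `D`.
  obtain ⟨m, hm, hmin⟩ : ∃ m, (∀ h : m < t, y < blockStart L D ⟨m, h⟩) ∧
      ∀ i (h : i < t), i < m → blockStart L D ⟨i, h⟩ ≤ y := by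
    refine ⟨Nat.find hex, Nat.find_spec hex, fun i h him => ?_⟩
    have := Nat.find_min hex him
    push Not at this
    exact this.2
  wlog hmt : m ≤ t generalizing m
  · exact this t (fun h => absurd h (lt_irrefl _)) (fun i h hi => hmin i h (by omega)) le_rfl
  have hbelow : ∀ i (h : i < t), i < m → (D ⟨i, h⟩ : ℕ) + m * (L - 1) < y := by
    intro i h him
    obtain ⟨m, rfl⟩ : ∃ m', m = m' + 1 := ⟨m - 1, by omega⟩
    have h₁ := hmin m (by omega) (by omega)
    have h₂ : blockStart L D ⟨m, by omega⟩ + L ≤ y := by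
      by_contra hlt
      exact hA ⟨⟨m, by omega⟩, y - blockStart L D ⟨m, by omega⟩, by omega, by omega⟩
    have h₃ : (D ⟨i, h⟩ : ℕ) ≤ D ⟨m, by omega⟩ := D.monotone (Fin.mk_le_mk.2 (by omega))
    simp only [blockStart] at h₂
    rw [add_mul, one_mul]
    omega
  have hge : m * (L - 1) ≤ y := by
    rcases Nat.eq_zero_or_pos m with rfl | hpos
    · simp
    · have := hbelow (m - 1) (by omega) (by omega)
      omega
  have habove : ∀ i (h : i < t), m ≤ i → y < D ⟨i, h⟩ + m * (L - 1) := by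
    intro i h him
    have h₁ := hm (by omega)
    have h₃ : (D ⟨m, by omega⟩ : ℕ) ≤ D ⟨i, h⟩ := D.monotone (Fin.mk_le_mk.2 (by omega))
    simp only [blockStart] at h₁
    omega
  have hk : y - m * (L - 1) < K := by
    rcases hmt.eq_or_lt with rfl | hlt
    · omega
    · have := habove m hlt le_rfl
      have := (D ⟨m, hlt⟩).2
      omega
  refine ⟨OrderEmbedding.ofStrictMono _ (strictMono_insertNth_of_lt D ⟨m, by omega⟩
    ⟨y - m * (L - 1), hk⟩ (fun i hi => ?_) fun i hi => ?_), ⟨m, by omega⟩, fun i => by simp, ?_⟩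
  · have := hbelow i i.2 (by simpa [Fin.lt_def] using hi)
    rw [Fin.lt_def]
    simp only [Fin.eta] at this ⊢
    omega
  · have := habove i i.2 (by simpa [Fin.le_def] using hi)
    rw [Fin.lt_def]
    simp only [Fin.eta] at this ⊢
    omega
  · simp
    omega

theorem accesses_add [NeZero K₁] (r : Fin K₁) {a l : ℕ} {x y : Fin K₂} (hLK₁ : L ≤ K₁)
    (hl : l < L) (hxy : ((x - y : Fin K₂) : ℕ) < L) :
    Accesses L (r + Fin.ofNat K₁ (a + l), x) (r + Fin.ofNat K₁ a, y) := by
  refine ⟨?_, hxy⟩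
  simp only [ofNat_add, add_sub_add_left_eq_sub, add_sub_cancel_left, Fin.val_ofNat]
  rwa [Nat.mod_eq_of_lt (by omega)]

/-- This is how a user decodes a coded packet: it cancels the terms that it knows and keeps its own.
-/
theorem eq_of_sum_eq {ι X : Type} [Fintype ι] [AddCommGroup X] {g g' : ι → X}
    (h : ∑ i, g i = ∑ i, g' i) (o : ι) (ho : ∀ i, i ≠ o → g i = g' i) : g o = g' o := by
  classical
  rw [← Finset.add_sum_erase _ _ (Finset.mem_univ o),
    ← Finset.add_sum_erase _ g' (Finset.mem_univ o),
    Finset.sum_congr rfl fun i hi => ho i (Finset.ne_of_mem_erase hi)] at h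
  exact add_right_cancel h

/-- The hybrid code. Cache-node `v` holds the subfile `(r, D, f)` of each file if, for some `i`,
`v = (r + blockStart L D i, f i)`. The user `(r + s, e i)`, where `s` is a position in the
`i`-th block of `D`, is served by a Partition PDA; the users whose first coordinate lies in no
block are served by the array of Maddah-Ali and Niesen. -/
theorem hasCode_hybrid {K t : ℕ} (hL : 1 ≤ L) (hLK₁ : L ≤ K₁) (hLK₂ : L ≤ K₂)
    (hK : K + (t + 1) * (L - 1) = K₁) (X : Type) [AddCommGroup X] :
    HasCode K₁ K₂ L N (Fin K₁ × (Fin (t + 1) ↪o Fin K) × (Fin (t + 1) → Fin K₂))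
      (Fin N × Fin (t + 1) × (Fin (t + 1) ↪o Fin K) × (Fin t → Fin K₂))
      ((Fin K₁ × (Fin (t + 1) ↪o Fin K) × Fin L × (Fin (t + 1) → Fin K₂) ×
          {x : Fin K₂ // L ≤ x.val}) ⊕
        (Fin K₁ × (Fin (t + 1 + 1) ↪o Fin K) × (Fin (t + 1 + 1) → Fin K₂))) X := by
  have : NeZero K₁ := ⟨by omega⟩
  have : NeZero K₂ := ⟨by omega⟩
  refine ⟨fun v W c => W c.1 (v.1 - Fin.ofNat K₁ (blockStart L c.2.2.1 c.2.1), c.2.2.1,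
      c.2.1.insertNth (α := fun _ => Fin K₂) v.2 c.2.2.2),
    fun d W => Sum.elim
      (fun c => ∑ i, W (d (c.1 + Fin.ofNat K₁ (blockStart L c.2.1 i + c.2.2.1), c.2.2.2.1 i))
        (c.1, c.2.1, Function.update c.2.2.2.1 i (c.2.2.2.1 i - c.2.2.2.2)))
      (fun c => ∑ o : Fin (t + 1 + 1), W (d (c.1 + Fin.ofNat K₁ (c.2.1 o + o * (L - 1)), c.2.2 o))
        (c.1, o.succAboveOrderEmb.trans c.2.1, fun i => c.2.2 (o.succAbove i))),
    fun d u W W' hs hp => ?_⟩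
  have known : ∀ n r D f i, Accesses L u (r + Fin.ofNat K₁ (blockStart L D i), f i) →
      W n (r, D, f) = W' n (r, D, f) := by
    intro n r D f i hv
    simpa using congrFun (hp _ hv) (n, i, D, i.removeNth f)
  funext ⟨r, D, f⟩
  obtain ⟨u₁, u₂⟩ := u
  obtain ⟨y, hy, rfl⟩ : ∃ y < K₁, u₁ = r + Fin.ofNat K₁ y := ⟨(u₁ - r).val, (u₁ - r).2, by simp⟩
  rcases mem_block_or_exists_insertNth hL D (hK.symm ▸ hy) with
    ⟨i, l, hl, rfl⟩ | ⟨E, o, hE, rfl⟩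
  · by_cases hx : ((u₂ - f i : Fin K₂) : ℕ) < L
    · exact known _ r D f i (accesses_add r hLK₁ hl hx)
    -- The user is the `i`-th addressee of this packet. The term of any `j ≠ i` alters coordinate
    -- `j` only, so its `i`-th coordinate is still `u₂` and an accessible node holds it.
    · have h := congrFun hs
        (.inl (r, D, ⟨l, hl⟩, Function.update f i u₂, ⟨u₂ - f i, not_lt.1 hx⟩))
      simpa using eq_of_sum_eq h i fun j hj => known _ r D _ i <| accesses_add r hLK₁ hl <| by
        simpa [hj.symm] using Nat.pos_of_ne_zero (by omega)
  · have h := congrFun hs (.inr (r, E, o.insertNth (α := fun _ => Fin K₂) u₂ f))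
    have hD : o.succAboveOrderEmb.trans E = D := by
      ext i
      simp [hE]
    have := eq_of_sum_eq h o fun o' ho => by
      obtain ⟨i, hi⟩ := Fin.exists_succAbove_eq ho.symm
      -- Removing `E o'` keeps the index of `E o` if `o < o'` and lowers it by one if `o' < o`. The
      -- user thus sits at the first or the last position of the block of `E o`.
      obtain ⟨l, hl, hpos⟩ : ∃ l < L, (E o : ℕ) + o * (L - 1) =
          blockStart L (o'.succAboveOrderEmb.trans E) i + l := by
        have hb : blockStart L (o'.succAboveOrderEmb.trans E) i = E o + i * (L - 1) := by
          simp [blockStart, hi]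
        rw [hb, ← hi]
        simp only [Fin.succAbove]
        split_ifs
        · exact ⟨0, by omega, by simp⟩
        · exact ⟨L - 1, by omega, by simp; ring⟩
      refine known _ r _ _ i ?_
      rw [hpos]
      refine accesses_add r hLK₁ hl ?_
      simpa [hi] using Nat.pos_of_ne_zero (by omega)
    simpa [hD] using this

/-! ### Counting, and comparison with the given arrays -/

/-- In a placement delivery array with `t` stars per row, an integer occurs at most `t + 1` times:
the array of Maddah-Ali and Niesen has the fewest integers relative to its number of rows. -/
theorem IsPDA.mul_sub_le {F K S Z t : ℕ} {P : StarArray F K S} (hP : IsPDA Z P)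
    (h4 : CondC4 t P) : F * (K - t) ≤ (t + 1) * S := by
  classical
  have hrow : ∀ j, (Finset.univ.filter fun k => P j k ≠ none).card = K - t := fun j => by
    have := Finset.card_filter_add_card_filter_not (s := Finset.univ) (fun k => P j k = none)
    rw [h4 j, Finset.card_univ, Fintype.card_fin] at this
    simp only [ne_eq]
    omega
  have hcount : (Finset.univ.filter fun p : Fin F × Fin K => P p.1 p.2 ≠ none).card =
      F * (K - t) := by
    rw [Finset.card_filter, Fintype.sum_prod_type]
    simp only [← Finset.card_filter, hrow, Finset.sum_const, Finset.card_univ, Fintype.card_fin,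
      smul_eq_mul]
  have hfib : ∀ s : Fin S,
      (Finset.univ.filter fun p : Fin F × Fin K => P p.1 p.2 = some s).card ≤ t + 1 := by
    intro s
    rcases Finset.eq_empty_or_nonempty
      (Finset.univ.filter fun p : Fin F × Fin K => P p.1 p.2 = some s) with h | ⟨⟨j₀, k₀⟩, h₀⟩
    · rw [h]
      simp
    · have h₀ : P j₀ k₀ = some s := by simpa using h₀
      -- By C3 the occurrences of `s` lie in distinct columns, and each of these columns except `k₀`
      -- has a star in row `j₀`.
      calc _ ≤ (insert k₀ (Finset.univ.filter fun k => P j₀ k = none)).card := by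
            refine Finset.card_le_card_of_injOn Prod.snd ?_ ?_
            · rintro ⟨j, k⟩ hp
              have hp : P j k = some s := by simpa using hp
              by_cases h : (j, k) = (j₀, k₀)
              · simp [(Prod.mk.inj h).2]
              · simp [(hP.c3 s j j₀ k k₀ h hp h₀).2]
            · rintro ⟨j, k⟩ hp ⟨j', k'⟩ hp' hk
              have hp : P j k = some s := by simpa using hp
              have hp' : P j' k' = some s := by simpa using hp'
              obtain rfl : k = k' := hk
              by_contra h
              rw [(hP.c3 s j j' k k h hp hp').1] at hp
              cases hp
        _ ≤ t + 1 := (Finset.card_insert_le _ _).trans (by rw [h4 j₀])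
  rw [← hcount]
  calc _ ≤ ((Finset.univ : Finset (Fin S)).biUnion fun s =>
        Finset.univ.filter fun p : Fin F × Fin K => P p.1 p.2 = some s).card := by
        refine Finset.card_le_card fun p hp => ?_
        simpa [Option.ne_none_iff_exists', eq_comm] using hp
    _ ≤ (Finset.univ : Finset (Fin S)).card * (t + 1) :=
        Finset.card_biUnion_le_card_mul _ _ _ fun s _ => hfib s
    _ = (t + 1) * S := by simp [mul_comm]

theorem card_orderEmbedding_fin (t K : ℕ) : Fintype.card (Fin t ↪o Fin K) = K.choose t := by
  rw [← Nat.card_eq_fintype_card, Nat.card_congr Set.powersetCard.ofFinEmbEquiv, Set.powersetCard.card,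
    Nat.card_fin]

theorem card_subtype_le_val (q z : ℕ) : Fintype.card {x : Fin q // z ≤ x.val} = q - z := by
  have h := Fintype.card_subtype_compl (fun x : Fin q => x.val < z)
  simp only [not_lt, Fintype.card_fin] at h
  rw [h, Fintype.card_subtype, Fin.card_filter_val_lt]
  omega

/-- The hybrid scheme attains the memory-load pair that any placement delivery array satisfying
C1-C4 promises. -/
theorem attainedByScheme_hybrid (hL : 1 ≤ L) (hLK : L < K₂) (hK : K₂ ≤ K₁) {t : ℕ} (ht : 1 ≤ t)
    (htK : t ≤ K₁ / L) {F S Z : ℕ} {P : StarArray F (K₁ - t * (L - 1)) S} (hP : IsPDA Z P)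
    (h4 : CondC4 t P) :
    AttainedByScheme K₁ K₂ L N ((N : ℝ) * t / ((K₁ : ℝ) * K₂))
      (((K₂ : ℝ) * t * L - t * (L : ℝ) ^ 2) / t + (K₂ : ℝ) * S / F) := by
  have hS := hP.mul_sub_le h4
  have hF := hP.F_pos
  have htL : t * L ≤ K₁ := (Nat.le_div_iff_mul_le (by omega)).1 htK
  have hKt : t ≤ K₁ - t * (L - 1) := by
    obtain ⟨l, rfl⟩ : ∃ l, L = l + 1 := ⟨L - 1, by omega⟩
    rw [mul_add, mul_one] at htL
    simp only [Nat.add_sub_cancel]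
    omega
  have hK' : K₁ - t * (L - 1) + t * (L - 1) = K₁ := by omega
  clear P hP h4
  generalize K₁ - t * (L - 1) = K at *
  obtain ⟨t, rfl⟩ : ∃ t', t = t' + 1 := ⟨t - 1, by omega⟩
  have e : ZMod 2 ≃ Packet 1 := Fintype.equivOfCardEq (by simp)
  have h := (hasCode_hybrid (N := N) hL (hLK.le.trans hK) hLK.le hK' (ZMod 2)).congr
    (.refl _) (.refl _) (.refl _) e
  have hC : 0 < K.choose (t + 1) := Nat.choose_pos hKt
  have hK₁ : 0 < K₁ := by omega
  have hK₂ : 0 < K₂ := by omega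
  have hC2 := Nat.choose_succ_right_eq K (t + 1)
  -- This is `S / F ≥ K.choose (t + 2) / K.choose (t + 1)`, so the second family of transmissions
  -- costs at most `K₂ * S / F`.
  have hmain : F * K.choose (t + 1 + 1) ≤ S * K.choose (t + 1) := by
    refine Nat.le_of_mul_le_mul_right ?_ (show 0 < t + 1 + 1 by omega)
    calc F * K.choose (t + 1 + 1) * (t + 1 + 1) = F * (K - (t + 1)) * K.choose (t + 1) := by
          rw [mul_assoc, hC2]
          ring
      _ ≤ (t + 1 + 1) * S * K.choose (t + 1) := by gcongr
      _ = _ := by ring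
  refine h.attainedByScheme one_pos ?_ ?_ ?_
  all_goals
    simp only [Fintype.card_prod, Fintype.card_sum, Fintype.card_fun, Fintype.card_fin,
      card_orderEmbedding_fin, card_subtype_le_val]
  · positivity
  · push_cast
    apply le_of_eq
    field_simp
    ring
  · push_cast [Nat.cast_sub hLK.le]
    have hR : (K.choose (t + 1 + 1) : ℝ) ≤ S / F * K.choose (t + 1) := by
      rw [div_mul_eq_mul_div, le_div_iff₀ (by exact_mod_cast hF), mul_comm]
      exact_mod_cast hmain
    have hload : ((K₂ : ℝ) * (t + 1) * L - (t + 1) * (L : ℝ) ^ 2) / (t + 1) = L * (K₂ - L) := by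
      field_simp
    rw [hload]
    calc _ ≤ (K₁ * (K.choose (t + 1) * (L * (K₂ ^ (t + 1) * (K₂ - L)))) +
          K₁ * ((S / F * K.choose (t + 1)) * K₂ ^ (t + 1 + 1)) : ℝ) := by gcongr
      _ = _ := by ring

theorem attainedByScheme_of_mem_hybridCorners (hL : 1 ≤ L) (hLK : L < K₂) (hK : K₂ ≤ K₁)
    {F' Z' S' : ℕ → ℕ} {P : ∀ t : ℕ, StarArray (F' t) (K₁ - t * (L - 1)) (S' t)}
    (hP : ∀ t ∈ Finset.Icc 1 (K₁ / L), IsPDA (Z' t) (P t) ∧ CondC4 t (P t)) {p : ℝ × ℝ}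
    (hp : p ∈ hybridCorners K₁ K₂ L N F' S') : AttainedByScheme K₁ K₂ L N p.1 p.2 := by
  rcases hp with (rfl | rfl) | ⟨t, ht, rfl⟩
  · exact attainedByScheme_zero_memory
  · exact attainedByScheme_zero_load (hLK.le.trans hK) hLK.le hL
  · obtain ⟨h₁, h₂⟩ := Finset.mem_Icc.1 ht
    exact attainedByScheme_hybrid hL hLK hK h₁ h₂ (hP t ht).1 (hP t ht).2

/-- The segment between the two extreme corners already lies over all of `[0, N / L ^ 2]`. -/
theorem exists_mem_convexHull_hybridCorners (hN : 1 ≤ N) (hL : 1 ≤ L) (F' S' : ℕ → ℕ) {M : ℝ}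
    (h₀ : 0 ≤ M) (h₁ : M ≤ (N : ℝ) / (L : ℝ) ^ 2) :
    ∃ y, (M, y) ∈ convexHull ℝ (hybridCorners K₁ K₂ L N F' S') := by
  have hpos : (0 : ℝ) < (N : ℝ) / (L : ℝ) ^ 2 := by positivity
  have hconv := convex_convexHull ℝ (hybridCorners K₁ K₂ L N F' S')
  have hA : ((0 : ℝ), (K₁ : ℝ) * K₂) ∈ convexHull ℝ (hybridCorners K₁ K₂ L N F' S') :=
    subset_convexHull _ _ (.inl (.inl rfl))
  have hB : ((N : ℝ) / (L : ℝ) ^ 2, (0 : ℝ)) ∈ convexHull ℝ (hybridCorners K₁ K₂ L N F' S') :=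
    subset_convexHull _ _ (.inl (.inr rfl))
  have h := hconv hA hB (sub_nonneg.2 ((div_le_one hpos).2 h₁)) (div_nonneg h₀ hpos.le)
    (sub_add_cancel _ _)
  simp only [Prod.smul_mk, Prod.mk_add_mk, smul_eq_mul, mul_zero, zero_add,
    div_mul_cancel₀ M hpos.ne'] at h
  exact ⟨_, h⟩

end MACC

theorem theorem3 (K₁ K₂ L N : ℕ) (hN : 1 ≤ N) (hL : 1 ≤ L) (hLK : L < K₂) (hK : K₂ ≤ K₁)
    -- for each `t ∈ [⌊K₁/L⌋]`, a `(K₁ - t(L-1), F' t, Z' t, S' t)` PDA satisfying C1-C5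
    (F' Z' S' : ℕ → ℕ)
    (P : ∀ t : ℕ, MACC.StarArray (F' t) (K₁ - t * (L - 1)) (S' t))
    (hP : ∀ t ∈ Finset.Icc 1 (K₁ / L),
      MACC.IsPDA (Z' t) (P t) ∧ MACC.CondC4 t (P t) ∧ MACC.CondC5 L (P t))
    -- for each such `t`, a Partition PDA with `t` blocks of `K₂` columns
    (H : ∀ t : ℕ, (Fin t → Fin K₂) → Fin t × Fin K₂ → Option (Fin (K₂ ^ t * (K₂ - L))))
    (hH : ∀ t ∈ Finset.Icc 1 (K₁ / L), MACC.IsPartitionPDA L (H t)) :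
    -- every corner point is attained exactly by a scheme
    (∀ p ∈ MACC.hybridCorners K₁ K₂ L N F' S', MACC.AttainedByScheme K₁ K₂ L N p.1 p.2) ∧
    -- the lower convex envelope of the corner points is achievable
    (∀ M : ℝ, 0 ≤ M → M ≤ (N : ℝ) / (L : ℝ) ^ 2 →
      MACC.Achievable K₁ K₂ L N M
        (MACC.lowerConvexEnvelope (MACC.hybridCorners K₁ K₂ L N F' S') M)) := by
  have hA : ∀ p ∈ MACC.hybridCorners K₁ K₂ L N F' S', MACC.AttainedByScheme K₁ K₂ L N p.1 p.2 :=
    fun p hp => MACC.attainedByScheme_of_mem_hybridCorners hL hLK hK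
      (fun t ht => ⟨(hP t ht).1, (hP t ht).2.1⟩) hp
  exact ⟨hA, fun M h₀ h₁ => MACC.achievable_lowerConvexEnvelope hN hA
    (MACC.exists_mem_convexHull_hybridCorners hN hL F' S' h₀ h₁)⟩
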